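/- Let $d\ge 1$ and let $D\subseteq\mathbb{R}^d$ be a centered symmetric convex body, i.e. a compact convex set with $0\in\operatorname{int} D$ and $D=-D$. Let $D^\circ=\{z\in\mathbb{R}^d : x\cdot z\le 1 \text{ for all } x\in D\}$ be its polar set and $|x|_{D^\circ}=\inf\{a>0 : x\in aD^\circ\}$ the norm it induces. Let $\Omega\subseteq\mathbb{R}^d$ be a closed countable set whose gap $$\delta=\delta_{D^\circ}(\Omega)=\sup_{z\in\mathbb{R}^d}\ \inf_{\omega\in\Omega}|\omega-z|_{D^\circ}\in[0,\infty]$$ (with $\inf\emptyset=+\infty$) satisfies $\delta<1/4$. For $\omega\in\Omega$ let $\mu_\omega$ be the Voronoi weight, i.e. the Lebesgue measure of $$V_\omega=\{z\in\mathbb{R}^d : |\omega-z|_{D^\circ}\le|\lambda-z|_{D^\circ}\ \text{ for all } \lambda\in\Omega,\ \lambda\ne\omega\}.$$ Let $L^2(D)$ be the space of square-integrable functions $f:\mathbb{R}^d\to\mathbb{C}$ that vanish almost everywhere outside $D$, and write $\hat f(\omega)=\int_{\mathbb{R}^d} f(x)e^{-2\pi i\,\omega\cdot x}\,dx$. Put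 $$\kappa=\left(\frac1{\sqrt{4\delta}}-1\right)\left(1-\frac1{d+2}\right),\qquad A=|D^\circ|\,|D|\left(\frac{\delta\kappa^2}{6}\right)^d\cos\!\left(2\pi\delta(1+\kappa)^2\right)^2,$$ where $|\cdot|$ of a set denotes Lebesgue measure. Then $A>0$ and $$A\,\|f\|_2^2\le\sum_{\omega\in\Omega}\mu_\omega|\hat f(\omega)|^2\qquad\text{for all } f\in L^2(D),$$ where the sum takes values in $[0,\infty]$. -/

import Mathlib

open MeasureTheory
open scoped ENNReal FourierTransform Pointwise

noncomputable section

/-- A centered symmetric convex body in `ℝᵈ`: a compact convex set that has `0` in its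
interior and satisfies `D = -D`. -/
structure IsCenteredSymmConvexBody {d : ℕ} (D : Set (EuclideanSpace ℝ (Fin d))) : Prop where
  isCompact : IsCompact D
  convex : Convex ℝ D
  zero_mem_interior : (0 : EuclideanSpace ℝ (Fin d)) ∈ interior D
  neg_eq : -D = D

/-- The polar set `D° = {z : x · z ≤ 1 for all x ∈ D}`. -/
def polarSet {d : ℕ} (D : Set (EuclideanSpace ℝ (Fin d))) : Set (EuclideanSpace ℝ (Fin d)) :=
  {z | ∀ x ∈ D, inner ℝ x z ≤ 1}

/-- The gap `sup_z inf_{ω ∈ Ω} |ω - z|_K` of `Ω` with respect to the norm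
`|x|_K = inf {a > 0 : x ∈ a K}`, which is Mathlib's `gauge K`. It takes values in `[0, ∞]`;
the gap of the empty set is `∞`. -/
def gap {d : ℕ} (K Ω : Set (EuclideanSpace ℝ (Fin d))) : ℝ≥0∞ :=
  ⨆ z : EuclideanSpace ℝ (Fin d), ⨅ ω ∈ Ω, ENNReal.ofReal (gauge K (ω - z))

/-- The Voronoi region of `ω` among the points of `Ω`, for the norm `|·|_K`. -/
def voronoiRegion {d : ℕ} (K Ω : Set (EuclideanSpace ℝ (Fin d)))
    (ω : EuclideanSpace ℝ (Fin d)) : Set (EuclideanSpace ℝ (Fin d)) :=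
  {z | ∀ l ∈ Ω, l ≠ ω → gauge K (ω - z) ≤ gauge K (l - z)}

/-- The Voronoi weight of `ω`: the Lebesgue measure of its Voronoi region. -/
def voronoiWeight {d : ℕ} (K Ω : Set (EuclideanSpace ℝ (Fin d)))
    (ω : EuclideanSpace ℝ (Fin d)) : ℝ≥0∞ :=
  volume (voronoiRegion K Ω ω)

/-- `f` represents an element of `L²(D)`: a square-integrable complex function on `ℝᵈ` that
vanishes almost everywhere outside `D`. -/
def MemL2On {d : ℕ} (D : Set (EuclideanSpace ℝ (Fin d)))
    (f : EuclideanSpace ℝ (Fin d) → ℂ) : Prop :=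
  MemLp f 2 volume ∧ ∀ᵐ x ∂(volume : Measure (EuclideanSpace ℝ (Fin d))), x ∉ D → f x = 0

/-- `κ = (1 / √(4δ) - 1) (1 - 1 / (d + 2))`. -/
def kappa (d : ℕ) (δ : ℝ) : ℝ :=
  (1 / √(4 * δ) - 1) * (1 - 1 / ((d : ℝ) + 2))

/-- `A = |D°| |D| (δ κ² / 6)ᵈ cos(2πδ(1 + κ)²)²`. -/
def lowerFrameBound {d : ℕ} (D : Set (EuclideanSpace ℝ (Fin d))) (δ : ℝ) : ℝ :=
  volume.real (polarSet D) * volume.real D * (δ * kappa d δ ^ 2 / 6) ^ d *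
    Real.cos (2 * Real.pi * δ * (1 + kappa d δ) ^ 2) ^ 2

end

/-! Let b be the indicator of E = κD and put T = δ(1+κ)². For fixed y the product F(x) = f̂(x) b̂(x
− y) has spectrum in (1+κ)D and vanishes at infinity, so |F| has a maximum point x₀. A band-limited
function cannot fall quickly from its maximum modulus: |F(ω)| ≥ cos(2πT)|F(x₀)| when |ω − x₀|_{D°} ≤
δ(1+κ) (`cos_mul_norm_integral_le`, `norm_fourier_mul_fourier_ge`). The Voronoi regions of these ω
cover x₀ + κδD°, so their weights add up to at least its volume
(`volume_mul_sq_le_tsum_voronoiWeight`). Since |F(x₀)| ≥ |F(y)| = |f̂(y)||E|, this bounds |f̂(y)|²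
by a weighted sum of |f̂(ω)|²|b̂(ω − y)|². Integrating over y, Plancherel on both sides removes y
and leaves the constant |D°||D|(δκ²)^d cos(2πT)², larger than A by the factor 6^d. -/

/-! ### Fourier expansion of an exponential with alternating coefficients -/

open Complex in
lemma integral_exp_mul_I_Icc {a : ℝ} (ha : a ≠ 0) :
    ∫ s in (-1 : ℝ)..1, cexp (I * a * s) = 2 * Real.sin a / a := by
  have hc : I * (a : ℂ) ≠ 0 := by simp [ha]
  have ha' : (a : ℂ) ≠ 0 := by simp [ha]
  rw [integral_exp_mul_complex hc, ofReal_sin, Complex.sin]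
  push_cast
  rw [show I * (a : ℂ) * 1 = a * I by ring, show I * (a : ℂ) * -1 = -a * I by ring]
  field_simp
  simp only [I_sq]
  ring

open Complex in
lemma integral_id_mul_exp_mul_I_Icc {b : ℝ} (hb : b ≠ 0) :
    ∫ s in (-1 : ℝ)..1, (s : ℂ) * cexp (I * b * s) =
      -2 * I * Real.cos b / b + 2 * I * Real.sin b / b ^ 2 := by
  have hb' : (b : ℂ) ≠ 0 := by simp [hb]
  have key : ∀ s : ℝ, HasDerivAt
      (fun s : ℝ => (-I * s / b + 1 / b ^ 2) * cexp (I * b * s)) (s * cexp (I * b * s)) s := by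
    intro s
    have h1 : HasDerivAt (fun s : ℝ => cexp (I * b * s)) (cexp (I * b * s) * (I * b * 1)) s :=
      ((ofRealCLM.hasDerivAt (x := s)).const_mul (I * (b : ℂ))).cexp
    have h2 : HasDerivAt (fun s : ℝ => (-I * s / b + 1 / (b : ℂ) ^ 2)) (-I * 1 / b) s :=
      (((ofRealCLM.hasDerivAt (x := s)).const_mul (-I)).div_const (b : ℂ)).add_const _
    refine (h2.mul h1).congr_deriv ?_
    have : I * I = -1 := I_mul_I
    field_simp
    linear_combination (-(s : ℂ) * b) * this
  rw [intervalIntegral.integral_eq_sub_of_hasDerivAt (fun s _ => key s)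
    (Continuous.intervalIntegrable (by fun_prop) _ _), ofReal_sin, ofReal_cos, Complex.sin,
    Complex.cos]
  push_cast
  rw [show I * (b : ℂ) * 1 = b * I by ring, show I * (b : ℂ) * -1 = -b * I by ring]
  field_simp
  ring_nf
  simp only [I_sq]
  ring

open Complex in
/-- The `n`-th Fourier coefficient of the `2`-periodic function that is
`exp (i s θ) - 1 - i s sin θ` for `s ∈ [-1, 1]`. -/
lemma integral_expansion_coeff {θ : ℝ} (h0 : 0 < θ) (h1 : θ < Real.pi) {n : ℤ} (hn : n ≠ 0) :
    ∫ s in (-1 : ℝ)..1, cexp (I * (-(Real.pi * n) : ℝ) * s) *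
        (cexp (I * s * θ) - 1 - I * s * Real.sin θ) =
      ((2 * ((-1) ^ n * (Real.sin θ * θ / (Real.pi * n * (θ - Real.pi * n)))) : ℝ) : ℂ) := by
  set b : ℝ := -(Real.pi * n) with hb
  have hn' : (n : ℝ) ≠ 0 := by exact_mod_cast hn
  have hb0 : b ≠ 0 := by simp [hb, hn, Real.pi_ne_zero]
  have ha0 : θ + b ≠ 0 := by
    intro h
    rcases lt_or_gt_of_ne hn with h' | h'
    · have : (n : ℝ) ≤ -1 := by exact_mod_cast (by omega : n ≤ -1)
      nlinarith [Real.pi_pos]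
    · have : (1 : ℝ) ≤ n := by exact_mod_cast (by omega : 1 ≤ n)
      nlinarith [Real.pi_pos]
  have hsplit : ∀ s : ℝ, cexp (I * b * s) * (cexp (I * s * θ) - 1 - I * s * Real.sin θ) =
      cexp (I * ((θ + b : ℝ) : ℂ) * s) - cexp (I * b * s) -
        I * Real.sin θ * (s * cexp (I * b * s)) := by
    intro s
    rw [show I * ((θ + b : ℝ) : ℂ) * s = I * b * s + I * s * θ by push_cast; ring, Complex.exp_add]
    ring
  simp_rw [hsplit]
  have hsb : Real.sin b = 0 := by
    rw [hb, Real.sin_neg, mul_comm, Real.sin_int_mul_pi, neg_zero]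
  have hcb : Real.cos b = (-1) ^ n := by
    rw [hb, Real.cos_neg, mul_comm, Real.cos_int_mul_pi]
  rw [intervalIntegral.integral_sub
      (Continuous.intervalIntegrable (by fun_prop) _ _)
      (Continuous.intervalIntegrable (by fun_prop) _ _),
    intervalIntegral.integral_sub
      (Continuous.intervalIntegrable (by fun_prop) _ _)
      (Continuous.intervalIntegrable (by fun_prop) _ _),
    intervalIntegral.integral_const_mul,
    integral_exp_mul_I_Icc ha0, integral_exp_mul_I_Icc hb0, integral_id_mul_exp_mul_I_Icc hb0,
    Real.sin_add, hsb, hcb]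
  have e1 : Real.pi * n = -b := by rw [hb]; ring
  rw [e1]
  have hb1 : (b : ℂ) ≠ 0 := by exact_mod_cast hb0
  have ha1 : (θ + b : ℂ) ≠ 0 := by exact_mod_cast ha0
  push_cast
  rw [sub_neg_eq_add]
  field_simp
  simp only [I_sq]
  ring

open Complex in
/-- An expansion of `exp (i s θ)` for `|s| ≤ 1` into frequencies `π n`, with real coefficients of
alternating sign. -/
lemma exists_exp_expansion {θ : ℝ} (h0 : 0 < θ) (h1 : θ < Real.pi / 2) :
    ∃ c : ℤ → ℝ, Summable c ∧ (∀ n, n ≠ 0 → (-1) ^ n * c n ≤ 0) ∧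
      ∀ s ∈ Set.Icc (-1 : ℝ) 1, HasSum (fun n : ℤ => (c n : ℂ) * cexp (I * s * (Real.pi * n : ℝ)))
        (cexp (I * s * θ) - 1 - I * s * Real.sin θ) := by
  have hpi := Real.pi_pos
  set φ : ℝ → ℂ := fun s => cexp (I * s * θ) - 1 - I * s * Real.sin θ with hφ
  -- The value at 0 is the mean of `φ`; the odd linear term contributes nothing to it.
  set c : ℤ → ℝ := fun n => if n = 0 then Real.sin θ / θ - 1 else
    (-1) ^ n * (Real.sin θ * θ / (Real.pi * n * (θ - Real.pi * n))) with hc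
  have hsin : 0 < Real.sin θ := Real.sin_pos_of_pos_of_lt_pi h0 (by linarith)
  have hφc : Continuous φ := by fun_prop
  -- Both values are cos θ − 1: subtracting i s sin θ removes the jump of the periodic extension, so
  -- the coefficients decay like n⁻².
  have hends : φ (-1) = φ (-1 + 2) := by
    norm_num [hφ, Complex.exp_mul_I, mul_comm I]
    rw [← neg_mul, Complex.exp_mul_I, Complex.cos_neg, Complex.sin_neg]
    ring
  have : Fact ((0 : ℝ) < 2) := ⟨two_pos⟩
  let g : C(AddCircle (2 : ℝ), ℂ) :=
    ⟨AddCircle.liftIco 2 (-1) φ, AddCircle.liftIco_continuous hends hφc.continuousOn⟩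
  have hgφ : ∀ s ∈ Set.Ico (-1 : ℝ) 1, g (s : AddCircle (2 : ℝ)) = φ s := by
    intro s hs
    have hs' : s ∈ Set.Ico (-1 : ℝ) (-1 + 2) := by
      norm_num at hs ⊢
      exact hs
    change AddCircle.liftIco 2 (-1) φ s = φ s
    rw [AddCircle.liftIco_coe_apply hs']
  have hfour : ∀ (n : ℤ) (s : ℝ), fourier n (s : AddCircle (2 : ℝ)) =
      cexp (I * s * (Real.pi * n : ℝ)) := by
    intro n s
    rw [fourier_coe_apply]
    congr 1
    push_cast
    ring
  have hcoeff : ∀ n, fourierCoeff g n = c n := by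
    intro n
    rw [fourierCoeff_eq_intervalIntegral g n (-1)]
    have : ∫ s in (-1 : ℝ)..(-1 + 2), fourier (-n) (s : AddCircle (2 : ℝ)) • g s =
        ∫ s in (-1 : ℝ)..1, cexp (I * (-(Real.pi * n) : ℝ) * s) * φ s := by
      rw [show (-1 + 2 : ℝ) = 1 by norm_num]
      refine intervalIntegral.integral_congr_Ioo_of_le (by norm_num) fun s hs => ?_
      simp only [smul_eq_mul]
      rw [hgφ s (Set.Ioo_subset_Ico_self hs), hfour]
      congr 2
      push_cast
      ring
    rw [this]
    by_cases hn : n = 0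
    · subst hn
      simp only [hφ, hc, if_true, Int.cast_zero, mul_zero, neg_zero, ofReal_zero, zero_mul,
        Complex.exp_zero, one_mul]
      have hsplit : ∀ s : ℝ, cexp (I * s * θ) - 1 - I * s * Real.sin θ =
          cexp (I * θ * s) - 1 - (I * Real.sin θ) * s := fun s => by
        rw [show I * s * (θ : ℂ) = I * θ * s by ring]
        ring
      simp_rw [hsplit]
      rw [intervalIntegral.integral_sub
          (Continuous.intervalIntegrable (by fun_prop) _ _)
          (Continuous.intervalIntegrable (by fun_prop) _ _),
        intervalIntegral.integral_sub
          (Continuous.intervalIntegrable (by fun_prop) _ _)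
          (Continuous.intervalIntegrable (by fun_prop) _ _),
        intervalIntegral.integral_const_mul, integral_exp_mul_I_Icc h0.ne',
        intervalIntegral.integral_ofReal]
      simp
      ring
    · rw [integral_expansion_coeff h0 (by linarith) hn]
      simp only [hc, if_neg hn, Complex.real_smul]
      push_cast
      ring
  have habs : ∀ n : ℤ, n ≠ 0 → Real.pi * |(n : ℝ)| / 2 ≤ |θ - Real.pi * n| := by
    intro n hn
    rcases lt_or_gt_of_ne hn with h' | h'
    · have : (n : ℝ) ≤ -1 := by exact_mod_cast (by omega : n ≤ -1)
      rw [abs_of_neg (by linarith), abs_of_pos (by nlinarith)]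
      nlinarith
    · have : (1 : ℝ) ≤ n := by exact_mod_cast (by omega : 1 ≤ n)
      rw [abs_of_pos (by linarith), abs_of_neg (by nlinarith)]
      nlinarith
  have hsum : Summable c := by
    have hs : Summable fun n : ℤ => 1 / (n : ℝ) ^ 2 := Real.summable_one_div_int_pow.2 one_lt_two
    refine Summable.of_norm_bounded_eventually hs ?_
    rw [Filter.eventually_cofinite]
    refine (Set.finite_singleton (0 : ℤ)).subset fun n hn => ?_
    by_contra hn0
    rw [Set.mem_singleton_iff] at hn0
    refine hn ?_
    simp only [hc, if_neg hn0, Real.norm_eq_abs, abs_mul, abs_div, abs_zpow, abs_neg, abs_one,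
      one_zpow, one_mul, abs_of_pos hsin, abs_of_pos h0, abs_of_pos hpi]
    have hn1 : 0 < |(n : ℝ)| := by simpa using hn0
    rw [← sq_abs (n : ℝ)]
    have h2 := habs n hn0
    have h3 : 0 < Real.pi * |(n : ℝ)| / 2 := by positivity
    rw [div_le_div_iff₀ (mul_pos (by positivity) (h3.trans_le h2)) (by positivity), one_mul]
    have hs1 := Real.sin_le_one θ
    have h4 : Real.sin θ * θ ≤ Real.pi / 2 := by nlinarith
    have h5 : 3 < Real.pi := Real.pi_gt_three
    calc Real.sin θ * θ * |(n : ℝ)| ^ 2 ≤ Real.pi / 2 * |(n : ℝ)| ^ 2 := by gcongr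
      _ ≤ Real.pi * |(n : ℝ)| * (Real.pi * |(n : ℝ)| / 2) := by
        have : 0 < |(n : ℝ)| ^ 2 := by positivity
        nlinarith [mul_pos hpi this]
      _ ≤ _ := by gcongr
  refine ⟨c, hsum, ?_, ?_⟩
  · intro n hn
    simp only [hc, if_neg hn]
    rw [← mul_assoc, ← mul_zpow]
    norm_num
    refine div_nonpos_of_nonneg_of_nonpos (by positivity) ?_
    -- Since 0 < θ < π, the factors n and θ − πn have opposite signs.
    rcases lt_or_gt_of_ne hn with h' | h'
    · have : (n : ℝ) ≤ -1 := by exact_mod_cast (by omega : n ≤ -1)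
      exact mul_nonpos_of_nonpos_of_nonneg (by nlinarith) (by nlinarith)
    · have : (1 : ℝ) ≤ n := by exact_mod_cast (by omega : 1 ≤ n)
      exact mul_nonpos_of_nonneg_of_nonpos (by nlinarith) (by nlinarith)
  · have hS : Summable (fourierCoeff g) := by
      rw [show fourierCoeff g = fun n => (c n : ℂ) from funext hcoeff]
      exact Complex.ofRealCLM.summable hsum
    have hper : ((1 : ℝ) : AddCircle (2 : ℝ)) = ((-1 : ℝ) : AddCircle (2 : ℝ)) := by
      rw [← AddCircle.coe_add_period (2 : ℝ) (-1)]
      norm_num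
    have hgφ' : ∀ s ∈ Set.Icc (-1 : ℝ) 1, g (s : AddCircle (2 : ℝ)) = φ s := by
      intro s hs
      rcases eq_or_lt_of_le hs.2 with rfl | hlt
      · rw [hper, hgφ _ ⟨le_rfl, by norm_num⟩, hends]
        norm_num
      · exact hgφ s ⟨hs.1, hlt⟩
    intro s hs
    have := has_pointwise_sum_fourier_series_of_summable hS (s : AddCircle (2 : ℝ))
    simpa only [hcoeff, hfour, hgφ' s hs, smul_eq_mul] using this

/-! ### Decay from the maximum modulus -/

open Complex in
/-- If `G t = ∫ w(x) exp(i s(x) t) dμ(x)` with `|s| ≤ 1` attains its maximum modulus at `0`,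
then `‖G θ‖ ≥ cos θ ‖G 0‖` for `0 < θ < π / 2`. -/
lemma cos_mul_norm_integral_le {X : Type*} [MeasurableSpace X] {μ : Measure X} {w : X → ℂ}
    {s : X → ℝ} (hw : Integrable w μ) (hs : Measurable s) (hs1 : ∀ x, w x ≠ 0 → |s x| ≤ 1)
    (hmax : ∀ t : ℝ, ‖∫ x, w x * cexp (I * s x * t) ∂μ‖ ≤ ‖∫ x, w x ∂μ‖)
    {θ : ℝ} (h0 : 0 < θ) (h1 : θ < Real.pi / 2) :
    Real.cos θ * ‖∫ x, w x ∂μ‖ ≤ ‖∫ x, w x * cexp (I * s x * θ) ∂μ‖ := by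
  obtain ⟨c, hc, hsign, hexp⟩ := exists_exp_expansion h0 h1
  set G : ℝ → ℂ := fun t => ∫ x, w x * cexp (I * s x * t) ∂μ with hG
  set M : ℝ := ‖∫ x, w x ∂μ‖ with hM
  have hG0 : G 0 = ∫ x, w x ∂μ := by simp [hG]
  -- Rotating by a unit u makes the maximal value real, so that Re(uG) lies in [−M, M] and attains M
  -- at 0.
  obtain ⟨u, hu, huM⟩ : ∃ u : ℂ, ‖u‖ = 1 ∧ u * G 0 = M := by
    by_cases h : G 0 = 0
    · exact ⟨1, by simp, by simp [hM, ← hG0, h]⟩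
    · refine ⟨(starRingEnd ℂ (G 0)) / ‖G 0‖, ?_, ?_⟩
      · simp [h]
      · have : (‖G 0‖ : ℂ) ≠ 0 := by simpa using h
        rw [hM, ← hG0, div_mul_eq_mul_div, div_eq_iff this, mul_comm, Complex.mul_conj,
          Complex.normSq_eq_norm_sq]
        push_cast
        ring
  have hnorm1 : ∀ (a : ℝ) (x : X), ‖cexp (I * s x * a)‖ = 1 := fun a x => by
    rw [show I * s x * a = ((s x * a : ℝ) : ℂ) * I by push_cast; ring, norm_exp_ofReal_mul_I]
  have hmeas : ∀ a : ℝ, AEStronglyMeasurable (fun x => cexp (I * s x * a)) μ := fun a =>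
    (by fun_prop : Measurable (fun x => cexp (I * s x * a))).aestronglyMeasurable
  have hint : ∀ a : ℝ, Integrable (fun x => w x * cexp (I * s x * a)) μ := fun a =>
    hw.mul_bdd (c := 1) (hmeas a) (Filter.Eventually.of_forall fun x => (hnorm1 a x).le)
  -- the derivative at `0`
  have hderiv := hasDerivAt_integral_of_dominated_loc_of_deriv_le (μ := μ) (x₀ := (0 : ℝ))
    (F := fun (t : ℝ) x => w x * cexp (I * s x * t))
    (F' := fun (t : ℝ) x => w x * (cexp (I * s x * t) * (I * s x))) (bound := fun x => ‖w x‖)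
    Filter.univ_mem (Filter.Eventually.of_forall fun t => (hint t).aestronglyMeasurable) (hint 0)
    (hw.aestronglyMeasurable.mul ((by fun_prop : Measurable
      (fun x => cexp (I * s x * (0 : ℝ)) * (I * s x))).aestronglyMeasurable))
    (Filter.Eventually.of_forall fun x t _ => by
      rw [norm_mul, norm_mul, hnorm1, one_mul, norm_mul, norm_I, one_mul, norm_real,
        Real.norm_eq_abs]
      by_cases h : w x = 0
      · simp [h]
      · exact mul_le_of_le_one_right (norm_nonneg _) (hs1 x h)) hw.norm
    (Filter.Eventually.of_forall fun x t _ => by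
      have : HasDerivAt (fun t : ℝ => cexp (I * s x * t)) (cexp (I * s x * t) * (I * s x * 1)) t :=
        ((ofRealCLM.hasDerivAt (x := t)).const_mul (I * (s x : ℂ))).cexp
      rw [mul_one] at this
      exact this.const_mul (w x))
  simp only [ofReal_zero, mul_zero, Complex.exp_zero, one_mul] at hderiv
  obtain ⟨hint', hderiv⟩ := hderiv
  set J : ℂ := ∫ x, w x * (I * s x) ∂μ with hJ
  have hre : ∀ t, (u * G t).re ≤ M := fun t => by
    refine (re_le_norm _).trans ?_
    rw [norm_mul, hu, one_mul]
    exact hmax t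
  have hre' : ∀ t, -M ≤ (u * G t).re := fun t => by
    have := (abs_le.1 (abs_re_le_norm (u * G t))).1
    rw [norm_mul, hu, one_mul] at this
    linarith [hmax t]
  -- This critical-point condition eliminates the linear term i s sin θ from the integrated
  -- expansion.
  have hJ0 : (u * J).re = 0 := by
    have h2 : HasDerivAt (fun t => (u * G t).re) (u * J).re 0 :=
      reCLM.hasFDerivAt.comp_hasDerivAt (0 : ℝ) (hderiv.const_mul u)
    refine IsLocalMax.hasDerivAt_eq_zero (Filter.Eventually.of_forall fun t => ?_) h2
    simp only [huM, ofReal_re]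
    exact hre t
  -- the expansion, integrated
  have hsum : HasSum (fun n : ℤ => (c n : ℂ) * G (Real.pi * n))
      (G θ - G 0 - Real.sin θ * J) := by
    have hterm : ∀ n : ℤ, Integrable
        (fun x => w x * ((c n : ℂ) * cexp (I * s x * (Real.pi * n : ℝ)))) μ := fun n => by
      refine ((hint (Real.pi * n)).const_mul (c n : ℂ)).congr
        (Filter.Eventually.of_forall fun x => ?_)
      simp only
      ring
    have h3 := hasSum_integral_of_summable_integral_norm hterm (by
      simp_rw [norm_mul, hnorm1, mul_one, integral_mul_const]
      exact (hc.norm.congr fun n => by simp).mul_left _)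
    have h4 : ∀ n : ℤ, ∫ x, w x * ((c n : ℂ) * cexp (I * s x * (Real.pi * n : ℝ))) ∂μ =
        (c n : ℂ) * G (Real.pi * n) := fun n => by
      rw [hG, ← integral_const_mul]
      congr 1 with x
      ring
    have h5 : ∫ x, ∑' n : ℤ, w x * ((c n : ℂ) * cexp (I * s x * (Real.pi * n : ℝ))) ∂μ =
        G θ - G 0 - Real.sin θ * J := by
      have h6 : ∀ x, ∑' n : ℤ, w x * ((c n : ℂ) * cexp (I * s x * (Real.pi * n : ℝ))) =
          w x * cexp (I * s x * θ) - w x - Real.sin θ * (w x * (I * s x)) := fun x => by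
        by_cases h : w x = 0
        · simp [h]
        · rw [((hexp (s x) (abs_le.1 (hs1 x h))).mul_left (w x)).tsum_eq]
          ring
      simp_rw [h6]
      have hA : Integrable (fun x => w x * cexp (I * s x * θ) - w x) μ := (hint θ).sub hw
      rw [integral_sub hA (hint'.const_mul _), integral_sub (hint θ) hw,
        integral_const_mul, hG0]
    simpa only [h4, h5] using h3
  have hsumR : HasSum (fun n : ℤ => c n * (u * G (Real.pi * n)).re) ((u * G θ).re - M) := by
    have h : HasSum (fun n : ℤ => (u * ((c n : ℂ) * G (Real.pi * n))).re)
        (u * (G θ - G 0 - Real.sin θ * J)).re := reCLM.hasSum (hsum.mul_left u)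
    rw [show u * (G θ - G 0 - Real.sin θ * J) = u * G θ - u * G 0 - (Real.sin θ : ℂ) * (u * J)
        by ring, sub_re, sub_re, huM, ofReal_re, re_ofReal_mul, hJ0, mul_zero, sub_zero] at h
    convert h using 2 with n
    rw [show u * ((c n : ℂ) * G (Real.pi * n)) = (c n : ℂ) * (u * G (Real.pi * n)) by ring,
      re_ofReal_mul]
  -- The expansion at s = 1, that is, the extremal case G(t) = M cos t, whose values at πn are
  -- (−1)ⁿM.
  have hsumC : HasSum (fun n : ℤ => c n * ((-1) ^ n * M)) ((Real.cos θ - 1) * M) := by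
    have h : HasSum (fun n : ℤ => ((c n : ℂ) * cexp (I * (1 : ℝ) * (Real.pi * n : ℝ))).re * M)
        ((cexp (I * (1 : ℝ) * θ) - 1 - I * (1 : ℝ) * Real.sin θ).re * M) :=
      (reCLM.hasSum (hexp 1 ⟨by norm_num, le_rfl⟩)).mul_right M
    have h6 : (cexp (I * (1 : ℝ) * θ) - 1 - I * (1 : ℝ) * Real.sin θ).re = Real.cos θ - 1 := by
      rw [show I * ((1 : ℝ) : ℂ) * (θ : ℂ) = (θ : ℂ) * I by push_cast; ring, sub_re, sub_re,
        exp_ofReal_mul_I_re, ofReal_one, mul_one, re_mul_ofReal, I_re, one_re]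
      ring
    rw [h6] at h
    convert h using 2 with n
    rw [re_ofReal_mul, show I * ((1 : ℝ) : ℂ) * ((Real.pi * n : ℝ) : ℂ) =
      ((n * Real.pi : ℝ) : ℂ) * I by push_cast; ring, exp_ofReal_mul_I_re, Real.cos_int_mul_pi]
    ring
  -- Termwise: for n ≠ 0 the sign of `c n` makes (−1)ⁿM the worst value in [−M, M]; at n = 0 both
  -- terms agree, whatever the sign of `c 0`.
  have hle : (Real.cos θ - 1) * M ≤ (u * G θ).re - M := by
    refine hasSum_le (fun n => ?_) hsumC hsumR
    by_cases hn : n = 0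
    · subst hn
      simp [huM]
    · have h6 := hsign n hn
      have h7 : ((-1 : ℝ)) ^ n = 1 ∨ ((-1 : ℝ)) ^ n = -1 :=
        (Int.even_or_odd n).imp Even.neg_one_zpow Odd.neg_one_zpow
      rcases h7 with h | h
      all_goals
        rw [h] at h6 ⊢
        nlinarith [hre (Real.pi * n), hre' (Real.pi * n)]
  calc Real.cos θ * M ≤ (u * G θ).re := by linarith
    _ ≤ ‖u * G θ‖ := re_le_norm _
    _ = ‖G θ‖ := by rw [norm_mul, hu, one_mul]

/-! ### Plancherel and products of Fourier transforms -/

/-- **Plancherel's theorem** for integrable and square-integrable functions. -/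
lemma eLpNorm_fourier_eq {V : Type*} [NormedAddCommGroup V] [InnerProductSpace ℝ V]
    [FiniteDimensional ℝ V] [MeasurableSpace V] [BorelSpace V] {f : V → ℂ}
    (hf1 : Integrable f) (hf2 : MemLp f 2) :
    eLpNorm (𝓕 f) 2 = eLpNorm f 2 := by
  set F := hf2.toLp f with hF
  have hcont : Continuous (𝓕 f) :=
    VectorFourier.fourierIntegral_continuous Real.continuous_fourierChar
      (by exact continuous_inner) hf1
  -- The Fourier integral and the L² transform have the same integrals against smooth compactly
  -- supported functions, by moving the transform onto the test function.
  have hae : 𝓕 f =ᵐ[volume] (𝓕 F : Lp ℂ 2 (volume : Measure V)) := by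
    refine ae_eq_of_integral_contDiff_smul_eq hcont.locallyIntegrable
      ((Lp.memLp (𝓕 F)).locallyIntegrable one_le_two) fun g hg hgs => ?_
    let φ : SchwartzMap V ℂ := HasCompactSupport.toSchwartzMap
      (f := fun x => (g x : ℂ)) (hgs.comp_left Complex.ofReal_zero)
      (Complex.ofRealCLM.contDiff.comp hg)
    have hφ : ∀ x, φ x = (g x : ℂ) := fun x => rfl
    have h1 : ∫ x, φ x • (𝓕 F : Lp ℂ 2 (volume : Measure V)) x = ∫ x, (𝓕 φ) x • F x := by
      have := congrArg (fun T => T φ) (Lp.fourier_toTemperedDistribution_eq F)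
      simp only [TemperedDistribution.fourier_apply, Lp.toTemperedDistribution_apply] at this
      exact this.symm
    have h2 : ∫ x, (𝓕 φ) x • F x = ∫ x, (𝓕 φ) x • f x := by
      refine integral_congr_ae ?_
      filter_upwards [hf2.coeFn_toLp] with x hx
      rw [hF, hx]
    have h3 : ∫ x, (𝓕 (φ : V → ℂ)) x • f x = ∫ x, φ x • 𝓕 f x := by
      simpa using! (VectorFourier.integral_fourierIntegral_smul_eq_flip (L := innerₗ V)
        Real.continuous_fourierChar continuous_inner φ.integrable hf1)
    have h4 : ∫ x, φ x • 𝓕 f x = ∫ x, φ x • (𝓕 F : Lp ℂ 2 (volume : Measure V)) x := by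
      rw [h1, h2, ← h3]
      rfl
    simpa [hφ] using h4
  rw [eLpNorm_congr_ae hae, ← Lp.enorm_def, ← eLpNorm_congr_ae hf2.coeFn_toLp, ← Lp.enorm_def,
    ← ofReal_norm, ← ofReal_norm, Lp.norm_fourier_eq]

lemma continuous_fourier_of_integrable {V : Type*} [NormedAddCommGroup V] [InnerProductSpace ℝ V]
    [FiniteDimensional ℝ V] [MeasurableSpace V] [BorelSpace V] {f : V → ℂ} (hf : Integrable f) :
    Continuous (𝓕 f) :=
  VectorFourier.fourierIntegral_continuous Real.continuous_fourierChar
    (by exact continuous_inner) hf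

/-- By Fubini the product is one Fourier integral over V × V with phase ⟨ξ + η, ·⟩. On the line
through x₀ in direction v this is the one-variable situation of `cos_mul_norm_integral_le`, and T <
1/4 says that θ = 2πT is below π/2. -/
lemma norm_fourier_mul_fourier_ge {V : Type*} [NormedAddCommGroup V] [InnerProductSpace ℝ V]
    [FiniteDimensional ℝ V] [MeasurableSpace V] [BorelSpace V] {a b : V → ℂ}
    (ha : Integrable a) (hb : Integrable b) {x₀ v y : V} {T : ℝ} (hT0 : 0 < T) (hT1 : T < 1 / 4)
    (hT : ∀ ξ η, a ξ ≠ 0 → b η ≠ 0 → |inner ℝ (ξ + η) v| ≤ T)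
    (hmax : ∀ x, ‖𝓕 a x * 𝓕 b (x - y)‖ ≤ ‖𝓕 a x₀ * 𝓕 b (x₀ - y)‖) :
    Real.cos (2 * Real.pi * T) * ‖𝓕 a x₀ * 𝓕 b (x₀ - y)‖ ≤
      ‖𝓕 a (x₀ + v) * 𝓕 b (x₀ + v - y)‖ := by
  have hpi := Real.pi_pos
  set A : V → V → ℂ := fun x ξ => Complex.exp ((-2 * Real.pi * inner ℝ ξ x : ℝ) * Complex.I) • a ξ
    with hA
  set B : V → V → ℂ := fun x ξ => Complex.exp ((-2 * Real.pi * inner ℝ ξ x : ℝ) * Complex.I) • b ξ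
    with hB
  have hbdd : ∀ (c : V → ℂ), Integrable c → ∀ x, Integrable
      fun ξ => Complex.exp ((-2 * Real.pi * inner ℝ ξ x : ℝ) * Complex.I) • c ξ := fun c hc x =>
    hc.bdd_mul (c := 1) (by fun_prop : Measurable fun ξ : V =>
      Complex.exp ((-2 * Real.pi * inner ℝ ξ x : ℝ) * Complex.I)).aestronglyMeasurable
      (Filter.Eventually.of_forall fun ξ => (Complex.norm_exp_ofReal_mul_I _).le)
  have hFA : ∀ x, 𝓕 a x = ∫ ξ, A x ξ := fun x => Real.fourier_eq' a x
  have hFB : ∀ x, 𝓕 b x = ∫ ξ, B x ξ := fun x => Real.fourier_eq' b x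
  set w : V × V → ℂ := fun p => A x₀ p.1 * B (x₀ - y) p.2 with hw
  -- Division by T gives |s| ≤ 1 on the support; the parameter t = 2πT then corresponds to the point
  -- x₀ + v.
  set s : V × V → ℝ := fun p => -inner ℝ (p.1 + p.2) v / T with hs
  have hG : ∀ t : ℝ, ∫ p, w p * Complex.exp (Complex.I * s p * t) =
      𝓕 a (x₀ + (t / (2 * Real.pi * T)) • v) * 𝓕 b (x₀ + (t / (2 * Real.pi * T)) • v - y) := by
    intro t
    rw [hFA, hFB, ← integral_prod_mul, ← Measure.volume_eq_prod]
    congr 1 with p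
    simp only [hw, hA, hB, hs, smul_eq_mul]
    have key : Complex.exp ((-2 * Real.pi * inner ℝ p.1 x₀ : ℝ) * Complex.I) *
        Complex.exp ((-2 * Real.pi * inner ℝ p.2 (x₀ - y) : ℝ) * Complex.I) *
        Complex.exp (Complex.I * (-inner ℝ (p.1 + p.2) v / T : ℝ) * t) =
        Complex.exp ((-2 * Real.pi * inner ℝ p.1 (x₀ + (t / (2 * Real.pi * T)) • v) : ℝ) *
          Complex.I) *
        Complex.exp ((-2 * Real.pi * inner ℝ p.2 (x₀ + (t / (2 * Real.pi * T)) • v - y) : ℝ) *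
          Complex.I) := by
      rw [← Complex.exp_add, ← Complex.exp_add, ← Complex.exp_add]
      congr 1
      rw [show x₀ + (t / (2 * Real.pi * T)) • v - y = (x₀ - y) + (t / (2 * Real.pi * T)) • v by
          abel, inner_add_right, inner_add_right p.2, inner_add_left, inner_smul_right,
        inner_smul_right]
      have h1 : (T : ℂ) ≠ 0 := by exact_mod_cast hT0.ne'
      have h2 : (Real.pi : ℂ) ≠ 0 := by exact_mod_cast hpi.ne'
      push_cast
      field_simp
      ring
    linear_combination (a p.1 * b p.2) * key
  have hG0 : ∫ p, w p = 𝓕 a x₀ * 𝓕 b (x₀ - y) := by simpa using hG 0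
  have hGθ := hG (2 * Real.pi * T)
  rw [div_self (by positivity), one_smul] at hGθ
  have := cos_mul_norm_integral_le (μ := (volume : Measure (V × V))) (w := w) (s := s)
    ((hbdd a ha x₀).mul_prod (hbdd b hb (x₀ - y))) (by fun_prop) (fun p hp => by
      have h1 : a p.1 ≠ 0 := fun h => hp (by simp [hw, hA, h])
      have h2 : b p.2 ≠ 0 := fun h => hp (by simp [hw, hB, h])
      rw [hs, abs_div, abs_neg, abs_of_pos hT0, div_le_one hT0]
      exact hT _ _ h1 h2)
    (fun t => by rw [hG, hG0]; exact hmax _) (θ := 2 * Real.pi * T) (by positivity)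
    (by nlinarith)
  rwa [hG0, hGθ] at this

/-- By Riemann–Lebesgue one factor tends to 0 at infinity while the other is bounded, so a
continuous product that is not identically zero attains its maximum modulus. -/
lemma exists_norm_fourier_mul_fourier_ge {V : Type*} [NormedAddCommGroup V]
    [InnerProductSpace ℝ V] [FiniteDimensional ℝ V] [MeasurableSpace V] [BorelSpace V]
    {a b : V → ℂ} (ha : Integrable a) (hb : Integrable b) (y : V) :
    ∃ x₀, ∀ x, ‖𝓕 a x * 𝓕 b (x - y)‖ ≤ ‖𝓕 a x₀ * 𝓕 b (x₀ - y)‖ := by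
  by_cases h : ∃ x₁, 𝓕 a x₁ * 𝓕 b (x₁ - y) ≠ 0
  · obtain ⟨x₁, hx₁⟩ := h
    have hca := continuous_fourier_of_integrable ha
    have hcb := continuous_fourier_of_integrable hb
    refine Continuous.exists_forall_ge' (f := fun x => ‖𝓕 a x * 𝓕 b (x - y)‖) (by fun_prop) x₁ ?_
    have h0 : Filter.Tendsto (𝓕 a) (Filter.cocompact V) (nhds 0) :=
      tendsto_integral_exp_inner_smul_cocompact a
    have hle : ∀ x, ‖𝓕 b (x - y)‖ ≤ ∫ ξ, ‖b ξ‖ := fun x =>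
      VectorFourier.norm_fourierIntegral_le_integral_norm _ _ _ _ _
    have h1 : Filter.Tendsto (fun x => ‖𝓕 a x‖ * ∫ ξ, ‖b ξ‖) (Filter.cocompact V) (nhds 0) := by
      simpa using h0.norm.mul_const (∫ ξ, ‖b ξ‖)
    filter_upwards [h1.eventually_le_const (norm_pos_iff.2 hx₁)] with x hx
    rw [norm_mul]
    exact (mul_le_mul_of_nonneg_left (hle x) (norm_nonneg _)).trans hx
  · push Not at h
    exact ⟨0, fun x => by rw [h x, h 0]⟩

/-! ### Polar sets, gaps and Voronoi regions -/

section Geometry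

variable {d : ℕ} {D K Ω : Set (EuclideanSpace ℝ (Fin d))}

lemma convex_polarSet : Convex ℝ (polarSet D) := by
  intro z hz w hw α β hα hβ hαβ x hx
  rw [inner_add_right, inner_smul_right, inner_smul_right]
  nlinarith [hz x hx, hw x hx]

lemma polarSet_mem_nhds_zero (hD : IsCompact D) : polarSet D ∈ nhds 0 := by
  obtain ⟨R, hR0, hR⟩ := hD.isBounded.exists_pos_norm_le
  refine Filter.mem_of_superset (Metric.ball_mem_nhds 0 (inv_pos.2 hR0)) fun z hz x hx => ?_
  rw [mem_ball_zero_iff] at hz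
  calc inner ℝ x z ≤ ‖x‖ * ‖z‖ := real_inner_le_norm x z
    _ ≤ R * R⁻¹ := by gcongr; exact hR x hx
    _ = 1 := mul_inv_cancel₀ hR0.ne'

lemma exists_polarSet_subset_closedBall (hD : 0 ∈ interior D) :
    ∃ R, 0 < R ∧ polarSet D ⊆ Metric.closedBall 0 R := by
  obtain ⟨r, hr, hrD⟩ := Metric.nhds_basis_closedBall.mem_iff.1 (mem_interior_iff_mem_nhds.1 hD)
  refine ⟨r⁻¹, inv_pos.2 hr, fun z hz => ?_⟩
  rw [mem_closedBall_zero_iff]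
  by_cases h : z = 0
  · simp [h, hr.le]
  have hz0 : 0 < ‖z‖ := norm_pos_iff.2 h
  have := hz ((r * ‖z‖⁻¹) • z) (hrD (by
    rw [mem_closedBall_zero_iff, norm_smul, norm_mul, norm_inv, norm_norm, mul_assoc,
      inv_mul_cancel₀ hz0.ne', mul_one, Real.norm_of_nonneg hr.le]))
  rw [real_inner_smul_left, real_inner_self_eq_norm_sq] at this
  rw [← one_div, le_div_iff₀ hr]
  calc ‖z‖ * r = r * ‖z‖⁻¹ * ‖z‖ ^ 2 := by field_simp
    _ ≤ 1 := this

lemma inner_le_gauge_polarSet (hK : Absorbent ℝ (polarSet D)) {x v : EuclideanSpace ℝ (Fin d)}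
    (hx : x ∈ D) : inner ℝ x v ≤ gauge (polarSet D) v := by
  refine le_of_forall_gt_imp_ge_of_dense fun a ha => ?_
  obtain ⟨b, hb0, hba, z, hz, rfl⟩ := exists_lt_of_gauge_lt hK ha
  simp only [inner_smul_right]
  nlinarith [hz x hx]

lemma abs_inner_le_gauge_polarSet (hD : IsCenteredSymmConvexBody D)
    {x : EuclideanSpace ℝ (Fin d)} (hx : x ∈ D) (v : EuclideanSpace ℝ (Fin d)) :
    |inner ℝ x v| ≤ gauge (polarSet D) v := by
  have hK := absorbent_nhds_zero (𝕜 := ℝ) (polarSet_mem_nhds_zero hD.isCompact)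
  have hx' : -x ∈ D := by rw [← hD.neg_eq]; simpa using hx
  rw [abs_le']
  refine ⟨inner_le_gauge_polarSet hK hx, ?_⟩
  rw [← inner_neg_left]
  exact inner_le_gauge_polarSet hK hx'

/-- Every point lies in the Voronoi region of a point of `Ω` at distance at most the gap. -/
lemma exists_mem_voronoiRegion (hKc : Convex ℝ K) (hK0 : K ∈ nhds 0) {R : ℝ} (hR : 0 < R)
    (hKR : K ⊆ Metric.closedBall 0 R) (hΩ : IsClosed Ω) (hgap : gap K Ω ≠ ∞)
    (z : EuclideanSpace ℝ (Fin d)) :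
    ∃ ω ∈ Ω, gauge K (ω - z) ≤ (gap K Ω).toReal ∧ z ∈ voronoiRegion K Ω ω := by
  have hle : ⨅ ω ∈ Ω, ENNReal.ofReal (gauge K (ω - z)) ≤ gap K Ω :=
    le_iSup (fun z => ⨅ ω ∈ Ω, ENNReal.ofReal (gauge K (ω - z))) z
  have hne : Ω.Nonempty := by
    by_contra h
    rw [Set.not_nonempty_iff_eq_empty] at h
    subst h
    simp only [Set.mem_empty_iff_false, iInf_false, iInf_top, top_le_iff] at hle
    exact hgap hle
  obtain ⟨ω₀, hω₀⟩ := hne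
  have hcont : Continuous fun ω => gauge K (ω - z) :=
    (continuous_gauge hKc hK0).comp (continuous_id.sub continuous_const)
  -- K is bounded, so its gauge is coercive and the distance from z to the closed set Ω is attained.
  have htend : Filter.Tendsto (fun ω => gauge K (ω - z)) (Filter.cocompact _) Filter.atTop := by
    refine Filter.tendsto_atTop_mono (f := fun ω => ‖ω - z‖ / R) (fun ω =>
      le_gauge_of_subset_closedBall (absorbent_nhds_zero hK0) hR.le hKR) ?_
    refine Filter.Tendsto.atTop_div_const hR (Filter.tendsto_atTop_mono (f := fun ω => ‖ω‖ - ‖z‖)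
      (fun ω => norm_sub_norm_le ω z) ?_)
    exact Filter.tendsto_atTop_add_const_right _ _ tendsto_norm_cocompact_atTop
  obtain ⟨ω, hω, hmin⟩ := hcont.continuousOn.exists_isMinOn' hΩ hω₀
    ((htend.eventually_ge_atTop (gauge K (ω₀ - z))).filter_mono inf_le_left)
  refine ⟨ω, hω, ?_, fun l hl _ => hmin hl⟩
  rw [← ENNReal.ofReal_le_iff_le_toReal hgap]
  refine le_trans (le_iInf₂ fun l hl => ?_) hle
  exact ENNReal.ofReal_le_ofReal (hmin hl)

/-- With zero gap every z would be a point of Ω, but a countable set is Lebesgue null. -/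
lemma gap_toReal_pos [Nontrivial (EuclideanSpace ℝ (Fin d))] (hKc : Convex ℝ K)
    (hK0 : K ∈ nhds 0) {R : ℝ} (hR : 0 < R) (hKR : K ⊆ Metric.closedBall 0 R) (hΩ : IsClosed Ω)
    (hΩc : Ω.Countable) (hgap : gap K Ω ≠ ∞) : 0 < (gap K Ω).toReal := by
  refine ENNReal.toReal_nonneg.lt_of_ne fun h => ?_
  have huniv : Ω = Set.univ := by
    refine Set.eq_univ_of_forall fun z => ?_
    obtain ⟨ω, hω, hle, -⟩ := exists_mem_voronoiRegion hKc hK0 hR hKR hΩ hgap z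
    have h0 : gauge K (ω - z) = 0 := le_antisymm (h ▸ hle) (gauge_nonneg _)
    rw [gauge_eq_zero (absorbent_nhds_zero hK0)
      ((NormedSpace.isVonNBounded_closedBall ℝ _ R).subset hKR), sub_eq_zero] at h0
    exact h0 ▸ hω
  have := hΩc.measure_zero volume
  rw [huniv] at this
  exact isOpen_univ.measure_ne_zero volume Set.univ_nonempty this

/-- A point of x₀ + rK lies in the region of some ω within δ of it, hence within δ + r of x₀. These
regions therefore cover x₀ + rK; only subadditivity of volume is needed, not disjointness. -/
lemma volume_mul_sq_le_tsum_voronoiWeight (hKc : Convex ℝ K) (hK0 : K ∈ nhds 0)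
    (hΩ : Ω.Countable) {δ r : ℝ} (hr : 0 ≤ r)
    (hcov : ∀ z, ∃ ω ∈ Ω, gauge K (ω - z) ≤ δ ∧ z ∈ voronoiRegion K Ω ω)
    (x₀ : EuclideanSpace ℝ (Fin d)) {H : EuclideanSpace ℝ (Fin d) → ℂ} {m : ℝ≥0∞}
    (hm : ∀ ω ∈ Ω, gauge K (ω - x₀) ≤ δ + r → m ≤ ‖H ω‖ₑ) :
    ENNReal.ofReal (r ^ d) * volume K * m ^ 2 ≤
      ∑' ω : Ω, voronoiWeight K Ω (ω : EuclideanSpace ℝ (Fin d)) * ‖H ω‖ₑ ^ 2 := by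
  classical
  have : Countable Ω := hΩ.to_subtype
  have hvol : volume (x₀ +ᵥ r • K) = ENNReal.ofReal (r ^ d) * volume K := by
    rw [measure_vadd, Measure.addHaar_smul_of_nonneg _ hr, finrank_euclideanSpace_fin]
  set S : Ω → Set (EuclideanSpace ℝ (Fin d)) := fun ω =>
    if gauge K (ω - x₀) ≤ δ + r then voronoiRegion K Ω ω else ∅ with hS
  have hsub : x₀ +ᵥ r • K ⊆ ⋃ ω, S ω := by
    rintro _ ⟨k, hk, rfl⟩
    obtain ⟨ω, hω, hle, hz⟩ := hcov (x₀ + k)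
    have h1 : gauge K (ω - x₀) ≤ δ + r := by
      have := gauge_add_le hKc (absorbent_nhds_zero hK0) (ω - (x₀ + k)) k
      rw [show ω - (x₀ + k) + k = ω - x₀ by abel] at this
      linarith [gauge_le_of_mem hr hk]
    refine Set.mem_iUnion.2 ⟨⟨ω, hω⟩, ?_⟩
    simp only [hS, if_pos h1]
    exact hz
  rw [← hvol]
  calc volume (x₀ +ᵥ r • K) * m ^ 2 ≤ (∑' ω, volume (S ω)) * m ^ 2 := by
        gcongr
        exact (measure_mono hsub).trans (measure_iUnion_le S)
    _ = ∑' ω, volume (S ω) * m ^ 2 := ENNReal.tsum_mul_right.symm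
    _ ≤ _ := ENNReal.tsum_le_tsum fun ω => by
        by_cases h : gauge K (ω - x₀) ≤ δ + r
        · simp only [hS, if_pos h]
          gcongr
          · rfl
          · exact hm ω ω.2 h
        · simp [hS, h]

end Geometry

/-! ### Constants and the sampling inequality -/

lemma eLpNorm_two_sq {X : Type*} [MeasurableSpace X] {μ : Measure X} (f : X → ℂ) :
    eLpNorm f 2 μ ^ 2 = ∫⁻ x, ‖f x‖ₑ ^ 2 ∂μ := by
  have := eLpNorm_nnreal_pow_eq_lintegral (f := f) (μ := μ) (p := 2) two_ne_zero
  simpa using this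

lemma kappa_pos (d : ℕ) {δ : ℝ} (h0 : 0 < δ) (h1 : δ < 1 / 4) : 0 < kappa d δ := by
  have hq0 : 0 < √(4 * δ) := Real.sqrt_pos.2 (by linarith)
  have hq1 : √(4 * δ) < 1 := by rw [Real.sqrt_lt' one_pos]; linarith
  have hd : (1 : ℝ) / (d + 2) < 1 := by
    rw [div_lt_one (by positivity)]
    linarith [(Nat.cast_nonneg d : (0 : ℝ) ≤ d)]
  exact mul_pos (sub_pos.2 (one_lt_one_div hq0 hq1)) (sub_pos.2 hd)

/-- The condition amounts to 1 + κ < 1/√(4δ), and the factor 1 − 1/(d+2) < 1 in κ makes it strict.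
-/
lemma mul_one_add_kappa_sq_lt (d : ℕ) {δ : ℝ} (h0 : 0 < δ) (h1 : δ < 1 / 4) :
    δ * (1 + kappa d δ) ^ 2 < 1 / 4 := by
  have hk := kappa_pos d h0 h1
  have hq0 : 0 < √(4 * δ) := Real.sqrt_pos.2 (by linarith)
  have hq1 : √(4 * δ) < 1 := by rw [Real.sqrt_lt' one_pos]; linarith
  have hq2 : √(4 * δ) ^ 2 = 4 * δ := Real.sq_sqrt (by linarith)
  have hlt : 1 + kappa d δ < 1 / √(4 * δ) := by
    have h3 : 0 < 1 / √(4 * δ) - 1 := sub_pos.2 (one_lt_one_div hq0 hq1)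
    have h4 : 0 < 1 / ((d : ℝ) + 2) := by positivity
    unfold kappa
    nlinarith [mul_pos h3 h4]
  have h5 : (1 + kappa d δ) * √(4 * δ) < 1 := (lt_div_iff₀ hq0).1 hlt
  have h6 : ((1 + kappa d δ) * √(4 * δ)) ^ 2 < 1 := by
    have : 0 < (1 + kappa d δ) * √(4 * δ) := by positivity
    nlinarith
  rw [mul_pow, hq2] at h6
  linarith

lemma fourier_indicator_one_zero {d : ℕ} {S : Set (EuclideanSpace ℝ (Fin d))}
    (hS : MeasurableSet S) :
    𝓕 (S.indicator fun _ => (1 : ℂ)) 0 = volume.real S := by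
  rw [Real.fourier_eq']
  simp [integral_indicator hS]

lemma eLpNorm_indicator_one_sq {d : ℕ} {S : Set (EuclideanSpace ℝ (Fin d))}
    (hS : MeasurableSet S) :
    eLpNorm (S.indicator fun _ => (1 : ℂ)) 2 volume ^ 2 = volume S := by
  rw [eLpNorm_two_sq, ← lintegral_indicator_one hS]
  congr 1 with x
  by_cases h : x ∈ S <;> simp [h]

/-- The argument works for every κ > 0 with δ(1+κ)² < 1/4 and gives a constant without the factor
6⁻ᵈ. -/
lemma weighted_sampling_bound {d : ℕ} {D Ω : Set (EuclideanSpace ℝ (Fin d))}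
    (hD : IsCenteredSymmConvexBody D) (hΩ : IsClosed Ω) (hΩc : Ω.Countable)
    (hgap : gap (polarSet D) Ω ≠ ∞) {δ κ : ℝ} (hδ : (gap (polarSet D) Ω).toReal = δ)
    (h0 : 0 < δ) (hκ : 0 < κ) (hT : δ * (1 + κ) ^ 2 < 1 / 4)
    {f : EuclideanSpace ℝ (Fin d) → ℂ} (hf : MemL2On D f) :
    ENNReal.ofReal (volume.real (polarSet D) * volume.real D * (δ * κ ^ 2) ^ d *
        Real.cos (2 * Real.pi * (δ * (1 + κ) ^ 2)) ^ 2) * eLpNorm f 2 volume ^ 2 ≤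
      ∑' ω : Ω, voronoiWeight (polarSet D) Ω (ω : EuclideanSpace ℝ (Fin d)) *
        ‖𝓕 f (ω : EuclideanSpace ℝ (Fin d))‖ₑ ^ 2 := by
  have hpi := Real.pi_pos
  have : Countable Ω := hΩc.to_subtype
  have hDm : MeasurableSet D := hD.isCompact.measurableSet
  have hDfin : volume D ≠ ∞ := hD.isCompact.measure_lt_top.ne
  -- reduce to `f` supported in `D`
  wlog hsupp : ∀ x, f x ≠ 0 → x ∈ D generalizing f with H
  · have hae : D.indicator f =ᵐ[volume] f := by
      filter_upwards [hf.2] with x hx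
      by_cases h : x ∈ D
      · simp [h]
      · simp [h, hx h]
    have hF : 𝓕 (D.indicator f) = 𝓕 f := by
      ext x
      rw [Real.fourier_eq', Real.fourier_eq']
      refine integral_congr_ae ?_
      filter_upwards [hae] with y hy
      rw [hy]
    have := H (f := D.indicator f) ⟨hf.1.indicator hDm, Filter.Eventually.of_forall fun x hx => by
      simp [hx]⟩ (fun x hx => Set.mem_of_indicator_ne_zero hx)
    rwa [eLpNorm_congr_ae hae, hF] at this
  have hind : D.indicator f = f := Set.indicator_eq_self.2 fun x hx => hsupp x hx
  have hf1 : Integrable f := by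
    have hfin : IsFiniteMeasure (volume.restrict D) := ⟨by simpa using hDfin.lt_top⟩
    rw [← hind, integrable_indicator_iff hDm]
    exact (hf.1.restrict D).integrable one_le_two
  set K := polarSet D with hK
  have hKc : Convex ℝ K := convex_polarSet
  have hK0 : K ∈ nhds 0 := polarSet_mem_nhds_zero hD.isCompact
  obtain ⟨R, hR, hKR⟩ := exists_polarSet_subset_closedBall hD.zero_mem_interior
  have hKfin : volume K ≠ ∞ := ((measure_mono hKR).trans_lt measure_closedBall_lt_top).ne
  have hcov := exists_mem_voronoiRegion hKc hK0 hR hKR hΩ hgap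
  rw [hδ] at hcov
  -- Window set: larger κ enlarges the ball to be covered but also the spectrum (1+κ)D.
  set E := κ • D with hE
  have hEc : IsCompact E := hD.isCompact.smul κ
  have hEm : MeasurableSet E := hEc.measurableSet
  have hEvol : volume E = ENNReal.ofReal (κ ^ d) * volume D := by
    rw [hE, Measure.addHaar_smul_of_nonneg _ hκ.le, finrank_euclideanSpace_fin]
  have hEfin : volume E ≠ ∞ := hEc.measure_lt_top.ne
  have hEpos : volume E ≠ 0 := by
    rw [hEvol]
    refine mul_ne_zero (by simpa using pow_pos hκ d) ?_
    exact (Measure.measure_pos_of_nonempty_interior volume ⟨0, hD.zero_mem_interior⟩).ne'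
  set b : EuclideanSpace ℝ (Fin d) → ℂ := E.indicator fun _ => 1 with hb
  have hb1 : Integrable b := (integrable_indicator_iff hEm).2 (integrableOn_const hEfin)
  have hb2 : MemLp b 2 := memLp_indicator_const 2 hEm 1 (Or.inr hEfin)
  set T := δ * (1 + κ) ^ 2 with hTdef
  have hT0 : 0 < T := by positivity
  have hcos : 0 < Real.cos (2 * Real.pi * T) :=
    Real.cos_pos_of_mem_Ioo ⟨by nlinarith [mul_pos hpi hT0], by nlinarith⟩
  set C : ℝ≥0∞ := ENNReal.ofReal ((κ * δ) ^ d) * volume K *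
    ENNReal.ofReal (Real.cos (2 * Real.pi * T)) ^ 2 with hC
  -- the pointwise estimate
  have hpt : ∀ y, C * volume E ^ 2 * ‖𝓕 f y‖ₑ ^ 2 ≤
      ∑' ω : Ω, voronoiWeight K Ω (ω : EuclideanSpace ℝ (Fin d)) *
        ‖𝓕 f (ω : EuclideanSpace ℝ (Fin d))‖ₑ ^ 2 *
          ‖𝓕 b ((ω : EuclideanSpace ℝ (Fin d)) - y)‖ₑ ^ 2 := by
    intro y
    obtain ⟨x₀, hx₀⟩ := exists_norm_fourier_mul_fourier_ge hf1 hb1 y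
    have hnear : ∀ ω ∈ Ω, gauge K (ω - x₀) ≤ δ + κ * δ →
        ENNReal.ofReal (Real.cos (2 * Real.pi * T)) * (‖𝓕 f y‖ₑ * volume E) ≤
          ‖𝓕 f ω * 𝓕 b (ω - y)‖ₑ := by
      intro ω _ hω
      have h1 := norm_fourier_mul_fourier_ge hf1 hb1 (x₀ := x₀) (v := ω - x₀) (y := y) hT0 hT
        (fun ξ η hξ hη => by
          have hη' : η ∈ E := Set.mem_of_indicator_ne_zero hη
          obtain ⟨η', hη'D, rfl⟩ := hη'
          have h2 := abs_inner_le_gauge_polarSet hD (hsupp ξ hξ) (ω - x₀)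
          have h3 := abs_inner_le_gauge_polarSet hD hη'D (ω - x₀)
          simp only [inner_add_left, real_inner_smul_left]
          calc |inner ℝ ξ (ω - x₀) + κ * inner ℝ η' (ω - x₀)|
              ≤ |inner ℝ ξ (ω - x₀)| + |κ * inner ℝ η' (ω - x₀)| := abs_add_le _ _
            _ = |inner ℝ ξ (ω - x₀)| + κ * |inner ℝ η' (ω - x₀)| := by
              rw [abs_mul, abs_of_pos hκ]
            _ ≤ (δ + κ * δ) + κ * (δ + κ * δ) := by
              gcongr
              · exact h2.trans hω
              · exact h3.trans hω
            _ = T := by rw [hTdef]; ring) hx₀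
      rw [add_sub_cancel] at h1
      -- At x = y the window factor is b̂(0) = |E|, so the maximum is at least |f̂(y)||E|.
      have h4 := hx₀ y
      rw [sub_self, hb, fourier_indicator_one_zero hEm, ← hb] at h4
      have h5 : Real.cos (2 * Real.pi * T) * ‖𝓕 f y * (volume.real E : ℂ)‖ ≤
          ‖𝓕 f ω * 𝓕 b (ω - y)‖ := (mul_le_mul_of_nonneg_left h4 hcos.le).trans h1
      have h6 := ENNReal.ofReal_le_ofReal h5
      rw [ENNReal.ofReal_mul hcos.le, ofReal_norm, ofReal_norm, enorm_mul] at h6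
      convert h6 using 3
      rw [← ofReal_norm, Complex.norm_real, Real.norm_of_nonneg measureReal_nonneg,
        ofReal_measureReal hEfin]
    have := volume_mul_sq_le_tsum_voronoiWeight hKc hK0 hΩc (r := κ * δ) (by positivity) hcov x₀
      hnear
    calc C * volume E ^ 2 * ‖𝓕 f y‖ₑ ^ 2 = ENNReal.ofReal ((κ * δ) ^ d) * volume K *
        (ENNReal.ofReal (Real.cos (2 * Real.pi * T)) * (‖𝓕 f y‖ₑ * volume E)) ^ 2 := by
          rw [hC]; ring
      _ ≤ _ := this
      _ = _ := by simp_rw [enorm_mul, mul_pow, mul_assoc]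
  -- integrate over `y`
  have hcb := continuous_fourier_of_integrable hb1
  have hmeas : ∀ ω : EuclideanSpace ℝ (Fin d), Measurable fun y => ‖𝓕 b (ω - y)‖ₑ ^ 2 := fun ω =>
    (hcb.comp (continuous_const.sub continuous_id)).measurable.enorm.pow_const 2
  have hint := lintegral_mono (μ := volume) hpt
  rw [lintegral_const_mul' _ _ (by finiteness), ← eLpNorm_two_sq, eLpNorm_fourier_eq hf1 hf.1,
    lintegral_tsum fun ω : Ω => ((hmeas ω).const_mul _).aemeasurable] at hint
  have hshift : ∀ ω : EuclideanSpace ℝ (Fin d), ∫⁻ y, ‖𝓕 b (ω - y)‖ₑ ^ 2 = volume E := fun ω => by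
    rw [lintegral_sub_left_eq_self (fun y => ‖𝓕 b y‖ₑ ^ 2) ω, ← eLpNorm_two_sq,
      eLpNorm_fourier_eq hb1 hb2, hb, eLpNorm_indicator_one_sq hEm]
  have hterm : ∀ ω : Ω, ∫⁻ y, voronoiWeight K Ω (ω : EuclideanSpace ℝ (Fin d)) *
        ‖𝓕 f (ω : EuclideanSpace ℝ (Fin d))‖ₑ ^ 2 *
          ‖𝓕 b ((ω : EuclideanSpace ℝ (Fin d)) - y)‖ₑ ^ 2 =
      voronoiWeight K Ω (ω : EuclideanSpace ℝ (Fin d)) *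
        ‖𝓕 f (ω : EuclideanSpace ℝ (Fin d))‖ₑ ^ 2 * volume E := fun ω => by
    rw [lintegral_const_mul _ (hmeas _), hshift]
  simp_rw [hterm] at hint
  -- The left side carries |E|² from b̂(0)², the right side only ‖b‖₂² = |E|; one factor cancels and
  -- the other supplies κᵈ|D|.
  rw [ENNReal.tsum_mul_right, show C * volume E ^ 2 * eLpNorm f 2 volume ^ 2 =
    C * volume E * eLpNorm f 2 volume ^ 2 * volume E by ring,
    ENNReal.mul_le_mul_iff_left hEpos hEfin] at hint
  convert hint using 2
  rw [hC, hEvol, measureReal_def, measureReal_def, ENNReal.ofReal_mul (by positivity),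
    ENNReal.ofReal_mul (by positivity), ENNReal.ofReal_mul (by positivity),
    ENNReal.ofReal_toReal hKfin, ENNReal.ofReal_toReal hDfin,
    show (δ * κ ^ 2) ^ d = (κ * δ) ^ d * κ ^ d by rw [← mul_pow]; ring,
    ENNReal.ofReal_mul (by positivity), ENNReal.ofReal_pow hcos.le]
  ring

theorem theorem1p1 (d : ℕ) (hd : 0 < d) (D Ω : Set (EuclideanSpace ℝ (Fin d)))
    (hD : IsCenteredSymmConvexBody D) (hΩ_closed : IsClosed Ω) (hΩ_countable : Ω.Countable)
    (hgap : gap (polarSet D) Ω < 1 / 4) :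
    0 < lowerFrameBound D (gap (polarSet D) Ω).toReal ∧
      ∀ f : EuclideanSpace ℝ (Fin d) → ℂ, MemL2On D f →
        ENNReal.ofReal (lowerFrameBound D (gap (polarSet D) Ω).toReal) * eLpNorm f 2 volume ^ 2 ≤
          ∑' ω : Ω, voronoiWeight (polarSet D) Ω (ω : EuclideanSpace ℝ (Fin d)) *
            ‖𝓕 f (ω : EuclideanSpace ℝ (Fin d))‖ₑ ^ 2 := by
  have hpi := Real.pi_pos
  have : Nonempty (Fin d) := ⟨⟨0, hd⟩⟩
  have hK0 : polarSet D ∈ nhds 0 := polarSet_mem_nhds_zero hD.isCompact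
  obtain ⟨R, hR, hKR⟩ := exists_polarSet_subset_closedBall hD.zero_mem_interior
  have hgap' : gap (polarSet D) Ω ≠ ∞ := hgap.ne_top
  have h0 := gap_toReal_pos convex_polarSet hK0 hR hKR hΩ_closed hΩ_countable hgap'
  have h1 : (gap (polarSet D) Ω).toReal < 1 / 4 := by
    have := ENNReal.toReal_strict_mono (by simp) hgap
    simpa using this
  set δ := (gap (polarSet D) Ω).toReal with hδ
  have hκ := kappa_pos d h0 h1
  have hT := mul_one_add_kappa_sq_lt d h0 h1
  have hT0 : 0 < δ * (1 + kappa d δ) ^ 2 := by positivity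
  have hcos : 0 < Real.cos (2 * Real.pi * (δ * (1 + kappa d δ) ^ 2)) :=
    Real.cos_pos_of_mem_Ioo ⟨by nlinarith [mul_pos hpi hT0], by nlinarith⟩
  have hD1 : 0 < volume.real D := ENNReal.toReal_pos
    (Measure.measure_pos_of_nonempty_interior volume ⟨0, hD.zero_mem_interior⟩).ne'
    hD.isCompact.measure_lt_top.ne
  have hK1 : 0 < volume.real (polarSet D) := ENNReal.toReal_pos
    (Measure.measure_pos_of_mem_nhds volume hK0).ne'
    ((measure_mono hKR).trans_lt measure_closedBall_lt_top).ne
  have hA : lowerFrameBound D δ = volume.real (polarSet D) * volume.real D *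
      (δ * kappa d δ ^ 2 / 6) ^ d *
        Real.cos (2 * Real.pi * (δ * (1 + kappa d δ) ^ 2)) ^ 2 := by
    rw [lowerFrameBound, mul_assoc (2 * Real.pi)]
  refine ⟨by rw [hA]; positivity, fun f hf => ?_⟩
  -- The bound already holds without dividing by 6, so A follows by monotonicity.
  refine le_trans ?_
    (weighted_sampling_bound hD hΩ_closed hΩ_countable hgap' hδ.symm h0 hκ hT hf)
  rw [hA]
  gcongr
  exact div_le_self (by positivity) (by norm_num)
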